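/- Let $\mathcal X,\mathcal Y$ be complex Hilbert spaces and let $H^2_{\mathcal Y}$ be the Hardy space of analytic functions $f(z)=\sum_{n\ge0}z^nf_n$ from the open unit disk $\mathbb D$ to $\mathcal Y$ with $\|f\|^2=\sum_n\|f_n\|^2<\infty$. Let $E\in\mathcal L(\mathcal X,\mathcal Y)$ and $T\in\mathcal L(\mathcal X)$ be such that the pair $(E,T)$ is output stable, i.e. the observability operator $\mathcal O_{E,T}\colon x\mapsto\sum_{n\ge0}z^nET^nx$ is bounded from $\mathcal X$ into $H^2_{\mathcal Y}$, and put $P:=\mathcal O_{E,T}^*\mathcal O_{E,T}$. For $f\in H^2_{\mathcal Y}$ put $(E^*f)^{\wedge L}(T^*):=\sum_{n\ge0}T^{*n}E^*f_n$ (weakly convergent series). Let $\mathbf x\in\mathcal X$, and write $\mathbf x^*=\langle\,\cdot\,,\mathbf x\rangle$. Assume that $P$ is positive definite (positive semidefinite with bounded inverse) and that $\mathbf x\mathbf x^*\le P$. An inner function in the Schur class $\mathcal S(\mathcal Y_0,\mathcal Y)$ is an analytic function $B$ on $\mathbb D$ whose values are contractions from $\mathcal Y_0$ to $\mathcal Y$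 and for which $h\mapsto Bh$ is an isometry from $H^2_{\mathcal Y_0}$ into $H^2_{\mathcal Y}$. (i) $I-zT$ is invertible for all $z\in\mathbb D$, and there are a Hilbert space $\mathcal Y_0$, which can be taken to be a closed subspace of $\mathcal Y$, and an inner function $B\in\mathcal S(\mathcal Y_0,\mathcal Y)$ with $$\frac{I_{\mathcal Y}-B(z)B(\zeta)^*}{1-z\overline\zeta}=E(I-zT)^{-1}P^{-1}(I-\overline\zeta T^*)^{-1}E^*\qquad(z,\zeta\in\mathbb D).\tag{$*$}$$ (ii) The inner function $B$ is unique up to a constant unitary factor on the right: if $B_1\in\mathcal S(\mathcal Y_1,\mathcal Y)$ and $B_2\in\mathcal S(\mathcal Y_2,\mathcal Y)$ are inner and both satisfy $(*)$, then there is a unitary operator $V\colon\mathcal Y_2\to\mathcal Y_1$ with $B_2(z)=B_1(z)V$ for all $z\in\mathbb D$. (iii) For every Hilbert space $\mathcal Y_0$ and every inner function $B\in\mathcal S(\mathcal Y_0,\mathcal Y)$ satisfying $(*)$, the set of all $f\in H^2_{\mathcal Y}$ with $\|f\|_{H^2_{\mathcal Y}}\le1$ and $(E^*f)^{\wedge L}(T^*)=\mathbf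 x$ is the set of all functions in $H^2_{\mathcal Y}$ of the form $$f(z)=E(I-zT)^{-1}P^{-1}\mathbf x+B(z)h(z),\qquad h\in H^2_{\mathcal Y_0},\quad \|h\|^2_{H^2_{\mathcal Y_0}}\le1-\mathbf x^*P^{-1}\mathbf x.$$ -/

import Mathlib

open scoped ComplexConjugate Complex.UnitDisc InnerProductSpace

noncomputable section

namespace Hardy

section Space

variable (Y : Type*) [NormedAddCommGroup Y] [InnerProductSpace ℂ Y]

/-- Square-summable sequences in `Y`. -/
abbrev Coeffs := lp (fun _ : ℕ => Y) 2

variable {Y} in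
theorem summable_pow_smul [CompleteSpace Y] (a : Coeffs Y) (z : 𝔻) :
    Summable fun n : ℕ => (z : ℂ) ^ n • a n := by
  refine Summable.of_norm_bounded
    ((summable_geometric_of_lt_one (norm_nonneg _) z.norm_lt_one).mul_left ‖a‖) fun n => ?_
  rw [norm_smul, norm_pow, mul_comm]
  gcongr
  exact lp.norm_apply_le_norm (by norm_num) a n

variable [CompleteSpace Y]

/-- The sum `z ↦ ∑ zⁿ aₙ` on the unit disc of a power series with square-summable coefficients. -/
def powerSeries : Coeffs Y →ₗ[ℂ] (𝔻 → Y) where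
  toFun a z := ∑' n : ℕ, (z : ℂ) ^ n • a n
  map_add' a b := by
    funext z
    simp only [Pi.add_apply, lp.coeFn_add, smul_add]
    exact (summable_pow_smul a z).tsum_add (summable_pow_smul b z)
  map_smul' c a := by
    funext z
    simp only [Pi.smul_apply, lp.coeFn_smul, RingHom.id_apply, smul_comm _ c]
    exact (summable_pow_smul a z).tsum_const_smul c

theorem powerSeries_injective : Function.Injective (powerSeries Y) := by
  rw [← LinearMap.ker_eq_bot, LinearMap.ker_eq_bot']
  intro a ha
  let p : FormalMultilinearSeries ℂ ℂ Y := fun n => ContinuousMultilinearMap.mkPiRing ℂ (Fin n) (a n)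
  have hp : ∀ n, p.coeff n = a n := fun n => by
    simp [p, FormalMultilinearSeries.coeff]
  have h : HasFPowerSeriesAt (fun _ : ℂ => (0 : Y)) p 0 := by
    rw [hasFPowerSeriesAt_iff]
    filter_upwards [Metric.ball_mem_nhds (0 : ℂ) one_pos] with z hz
    have hz' : ‖z‖ < 1 := by simpa using hz
    have h1 := (summable_pow_smul a (Complex.UnitDisc.mk z hz')).hasSum
    have h2 := congrFun ha (Complex.UnitDisc.mk z hz')
    simp only [powerSeries, LinearMap.coe_mk, AddHom.coe_mk, Pi.zero_apply] at h2
    rw [h2] at h1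
    simpa [hp] using h1
  have h0 := h.eq_zero
  ext n
  rw [← hp n, h0]
  simp [FormalMultilinearSeries.coeff]

/-- The Hardy space `H²_Y`: the analytic `Y`-valued functions on the unit disc with
square-summable Taylor coefficients, that is, the sums `z ↦ ∑ zⁿ aₙ` with `∑ ‖aₙ‖² < ∞`. -/
def H2 : Type _ := LinearMap.range (powerSeries Y)

namespace H2

instance : AddCommGroup (H2 Y) := inferInstanceAs (AddCommGroup (LinearMap.range (powerSeries Y)))

instance : Module ℂ (H2 Y) := inferInstanceAs (Module ℂ (LinearMap.range (powerSeries Y)))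

variable {Y} in
instance : CoeFun (H2 Y) fun _ => 𝔻 → Y := ⟨fun f => f.1⟩

/-- The sequence of Taylor coefficients at `0` of a function in `H²_Y`. -/
def taylor : H2 Y ≃ₗ[ℂ] Coeffs Y := (LinearEquiv.ofInjective _ (powerSeries_injective Y)).symm

/-- The norm of `H²_Y`: `‖f‖² = ∑ ‖fₙ‖²` for `f(z) = ∑ zⁿ fₙ`. -/
instance : NormedAddCommGroup (H2 Y) :=
  NormedAddCommGroup.induced (H2 Y) (Coeffs Y) (taylor Y) (taylor Y).injective

/-- The inner product of `H²_Y`: `⟪f, g⟫ = ∑ ⟪fₙ, gₙ⟫`. -/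
instance : InnerProductSpace ℂ (H2 Y) := InnerProductSpace.induced (taylor Y)

instance : CompleteSpace (H2 Y) :=
  (LinearIsometryEquiv.mk (taylor Y) fun _ => rfl : H2 Y ≃ₗᵢ[ℂ] Coeffs Y).toIsometryEquiv.completeSpace

variable {Y} in
/-- The `n`-th Taylor coefficient `fₙ` of `f(z) = ∑ zⁿ fₙ`. -/
def coeff (f : H2 Y) (n : ℕ) : Y := taylor Y f n

variable {Y} in
/-- Every `f` in `H²_Y` is the sum of its Taylor series. -/
theorem hasSum_coeff (f : H2 Y) (z : 𝔻) : HasSum (fun n : ℕ => (z : ℂ) ^ n • f.coeff n) (f z) := by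
  have h : powerSeries Y (taylor Y f) = f.1 :=
    congrArg Subtype.val ((LinearEquiv.ofInjective _ (powerSeries_injective Y)).apply_symm_apply f)
  rw [← h]
  exact (summable_pow_smul (taylor Y f) z).hasSum

end H2

end Space

section Pairs

variable {X Y : Type*} [NormedAddCommGroup X] [InnerProductSpace ℂ X] [CompleteSpace X]
  [NormedAddCommGroup Y] [InnerProductSpace ℂ Y] [CompleteSpace Y]

/-- The pair `(E, T)` is output stable: `x ↦ ∑ zⁿ E Tⁿ x` is a bounded operator
from `X` into `H²_Y`. -/
def OutputStable (E : X →L[ℂ] Y) (T : X →L[ℂ] X) : Prop :=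
  ∃ O : X →L[ℂ] H2 Y, ∀ (x : X) (z : 𝔻),
    HasSum (fun n : ℕ => (z : ℂ) ^ n • E ((T ^ n) x)) (O x z)

/-- The observability operator `O_{E,T} : x ↦ ∑ zⁿ E Tⁿ x` of an output stable pair. -/
def observability {E : X →L[ℂ] Y} {T : X →L[ℂ] X} (h : OutputStable E T) : X →L[ℂ] H2 Y :=
  h.choose

/-- The observability gramian `P = O_{E,T}* O_{E,T}` of an output stable pair. -/
def gramian {E : X →L[ℂ] Y} {T : X →L[ℂ] X} (h : OutputStable E T) : X →L[ℂ] X :=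
  (observability h).adjoint ∘L observability h

/-- The left-tangential operator-argument evaluation `(E* f)^L(T*)` has the value `v`: the series
`∑ T*ⁿ E* fₙ` converges weakly in `X` to `v`. -/
def HasLeftEval (E : X →L[ℂ] Y) (T : X →L[ℂ] X) (f : H2 Y) (v : X) : Prop :=
  ∀ u : X, HasSum (fun n : ℕ => ⟪u, (T.adjoint ^ n) (E.adjoint (f.coeff n))⟫_ℂ) ⟪u, v⟫_ℂ

/-- A bounded operator is positive definite if it is positive semidefinite and has a bounded
inverse. -/
def PositiveDefinite (P : X →L[ℂ] X) : Prop := P.IsPositive ∧ IsUnit P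

/-- The kernel `E (I - z T)⁻¹ P⁻¹ (I - ζ̄ T*)⁻¹ E*`. -/
def gramKernel (E : X →L[ℂ] Y) (T P : X →L[ℂ] X) (z ζ : 𝔻) : Y →L[ℂ] Y :=
  E ∘L Ring.inverse (1 - (z : ℂ) • T) ∘L Ring.inverse P ∘L
    Ring.inverse (1 - conj (ζ : ℂ) • T.adjoint) ∘L E.adjoint

end Pairs

section Schur

variable {U Y : Type*} [NormedAddCommGroup U] [InnerProductSpace ℂ U] [CompleteSpace U]
  [NormedAddCommGroup Y] [InnerProductSpace ℂ Y] [CompleteSpace Y]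

/-- The Schur class `S(U, Y)`: functions that are analytic on the unit disc with contractions
as values there. (Only the restriction to the unit disc matters.) -/
def IsSchur (S : ℂ → U →L[ℂ] Y) : Prop :=
  DifferentiableOn ℂ S (Metric.ball 0 1) ∧ ∀ z ∈ Metric.ball (0 : ℂ) 1, ‖S z‖ ≤ 1

/-- Inner functions in the Schur class: multiplication by `S` is an isometry from `H²_U`
into `H²_Y`. -/
def IsInner (S : ℂ → U →L[ℂ] Y) : Prop :=
  IsSchur S ∧ ∀ h : H2 U, ∃ g : H2 Y, (∀ z : 𝔻, g z = S z (h z)) ∧ ‖g‖ = ‖h‖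

/-- The de Branges–Rovnyak kernel `(I - S(z) S(ζ)*) / (1 - z ζ̄)`. -/
def dBRKernel (S : ℂ → U →L[ℂ] Y) (z ζ : 𝔻) : Y →L[ℂ] Y :=
  (1 - (z : ℂ) * conj (ζ : ℂ))⁻¹ • (1 - S z ∘L (S ζ).adjoint)

end Schur

end Hardy

end

/-! Write `S` for the shift on `H²_Y`, `O` for the observability operator, `P = O* O`, and `M_B` for
multiplication by `B`. Everything reduces to one equivalence, `dBRKernel_eq_gramKernel_iff`: the
identity (*) holds if and only if the range of `M_B` is `ker O*`. Indeed, the two sides of (*) are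
the operators `I - M_B M_B*` and `O P⁻¹ O*` compressed between point evaluations (`dBRKernel_eq`,
`gramKernel_eq`). The reproducing kernel functions span a dense subspace, so (*) says that these
operators agree. The first is the projection onto the complement of the range of `M_B`, the second
the projection onto the range of `O`.

Existence: `S* O = O T` makes `ker O*` invariant under `S`, and the Beurling–Lax theorem applies.
That the coefficient space embeds in `Y` is a dimension count for wandering subspaces
(`IsWandering.nonempty_linearIsometry`).

Uniqueness: two isometric multipliers with the same range carry the constants onto the same
wandering subspace, which gives the unitary factor.

Parametrization: the interpolation condition says `O* f = x`. Its solutions are `O P⁻¹ x + ker O*`,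
an orthogonal sum, and `‖O P⁻¹ x‖² = ⟪x, P⁻¹ x⟫`, so the norm bound is Pythagoras.

Resolvents: `O` is bounded below and intertwines `T` with the contraction `S*`, so `T` is power
bounded. -/

noncomputable section

namespace Hardy

/-! ### Hardy space: coefficients, evaluations, shifts and the reproducing kernel. -/

namespace H2

theorem memℓp_two {F : Type*} [NormedAddCommGroup F] {a : ℕ → F} (h : Summable fun n => ‖a n‖ ^ 2) : Memℓp a 2 :=
  memℓp_gen (by simpa using h)

variable {Y : Type*} [NormedAddCommGroup Y] [InnerProductSpace ℂ Y] [CompleteSpace Y]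

theorem ext_apply {f g : H2 Y} (h : ∀ z : 𝔻, f z = g z) : f = g :=
  Subtype.ext (funext h)

theorem ext_coeff {f g : H2 Y} (h : ∀ n, f.coeff n = g.coeff n) : f = g :=
  (taylor Y).injective (lp.ext (funext h))

variable (Y) in
/-- The isometric identification of `H²_Y` with the sequences of Taylor coefficients. -/
def taylorIsometry : H2 Y ≃ₗᵢ[ℂ] Coeffs Y := ⟨taylor Y, fun _ => rfl⟩

/-- The function in `H²_Y` with given Taylor coefficients. -/
def ofCoeffs (a : Coeffs Y) : H2 Y := (taylorIsometry Y).symm a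

@[simp]
theorem coeff_ofCoeffs (a : Coeffs Y) (n : ℕ) : (ofCoeffs a).coeff n = a n := by
  have h : taylor Y (ofCoeffs a) = a := (taylorIsometry Y).apply_symm_apply a
  rw [coeff, h]

theorem coeff_add (f g : H2 Y) (n : ℕ) : (f + g).coeff n = f.coeff n + g.coeff n := by
  simp [coeff]

theorem coeff_smul (c : ℂ) (f : H2 Y) (n : ℕ) : (c • f).coeff n = c • f.coeff n := by
  simp [coeff]

theorem coeff_zero (n : ℕ) : (0 : H2 Y).coeff n = 0 := by
  simp [coeff]

theorem hasSum_norm_sq (f : H2 Y) : HasSum (fun n => ‖f.coeff n‖ ^ 2) (‖f‖ ^ 2) := by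
  simpa using! lp.hasSum_norm (p := 2) (by norm_num) (taylor Y f)

theorem hasSum_inner (f g : H2 Y) : HasSum (fun n => ⟪f.coeff n, g.coeff n⟫_ℂ) ⟪f, g⟫_ℂ :=
  lp.hasSum_inner (taylor Y f) (taylor Y g)

theorem norm_coeff_le (f : H2 Y) (n : ℕ) : ‖f.coeff n‖ ≤ ‖f‖ :=
  lp.norm_apply_le_norm (by norm_num) (taylor Y f) n

variable (Y) in
/-- The `n`-th Taylor coefficient as a bounded operator. -/
def coeffL (n : ℕ) : H2 Y →L[ℂ] Y :=
  LinearMap.mkContinuous ⟨⟨fun f => f.coeff n, fun f g => coeff_add f g n⟩,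
    fun c f => coeff_smul c f n⟩ 1 fun f => by simpa using norm_coeff_le f n

@[simp]
theorem coeffL_apply (n : ℕ) (f : H2 Y) : coeffL Y n f = f.coeff n := rfl

theorem norm_coeffL_le (n : ℕ) : ‖coeffL Y n‖ ≤ 1 := LinearMap.mkContinuous_norm_le _ zero_le_one _

theorem norm_apply_le (f : H2 Y) (z : 𝔻) : ‖f z‖ ≤ (1 - ‖(z : ℂ)‖)⁻¹ * ‖f‖ := by
  have hg := (hasSum_geometric_of_lt_one (norm_nonneg (z : ℂ)) z.norm_lt_one).mul_right ‖f‖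
  rw [← (hasSum_coeff f z).tsum_eq]
  refine tsum_of_norm_bounded hg fun n => ?_
  rw [norm_smul, norm_pow]
  gcongr
  exact norm_coeff_le f n

variable (Y) in
/-- Point evaluation as a bounded operator. -/
def eval (z : 𝔻) : H2 Y →L[ℂ] Y :=
  LinearMap.mkContinuous ⟨⟨fun f => f z, fun _ _ => rfl⟩, fun _ _ => rfl⟩
    (1 - ‖(z : ℂ)‖)⁻¹ fun f => norm_apply_le f z

@[simp]
theorem eval_apply (z : 𝔻) (f : H2 Y) : eval Y z f = f z := rfl

theorem add_apply (f g : H2 Y) (z : 𝔻) : (f + g) z = f z + g z := rfl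

variable (Y) in
/-- The constant functions. -/
def const : Y →ₗᵢ[ℂ] H2 Y where
  toFun y := ofCoeffs (lp.single 2 0 y)
  map_add' y y' := by simp [ofCoeffs]
  map_smul' c y := by simp [ofCoeffs]
  norm_map' y := by
    refine ((taylorIsometry Y).symm.norm_map _).trans ?_
    exact lp.norm_single (E := fun _ : ℕ => Y) (p := 2) (by norm_num) 0 y

@[simp]
theorem coeff_const_zero (y : Y) : (const Y y).coeff 0 = y := by
  change (ofCoeffs (lp.single 2 0 y)).coeff 0 = y
  simp

@[simp]
theorem coeff_const_succ (y : Y) (n : ℕ) : (const Y y).coeff (n + 1) = 0 := by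
  change (ofCoeffs (lp.single 2 0 y)).coeff (n + 1) = 0
  simp

@[simp]
theorem const_apply (y : Y) (z : 𝔻) : const Y y z = y := by
  refine (hasSum_coeff _ z).unique ?_
  convert hasSum_single (f := fun n : ℕ => (z : ℂ) ^ n • (const Y y).coeff n) 0 ?_ using 1
  · simp
  · rintro (_ | n) hn
    · exact absurd rfl hn
    · simp

theorem inner_const_left (y : Y) (f : H2 Y) : ⟪const Y y, f⟫_ℂ = ⟪y, f.coeff 0⟫_ℂ := by
  refine (hasSum_inner _ f).unique ?_
  convert hasSum_single (f := fun n : ℕ => ⟪(const Y y).coeff n, f.coeff n⟫_ℂ) 0 ?_ using 1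
  · simp
  · rintro (_ | n) hn
    · exact absurd rfl hn
    · simp

/-- A sequence shifted one place to the right. -/
def shiftSeq (a : ℕ → Y) : ℕ → Y
  | 0 => 0
  | n + 1 => a n

theorem hasSum_shiftSeq (f : H2 Y) :
    HasSum (fun n => ‖shiftSeq f.coeff n‖ ^ 2) (‖f‖ ^ 2) := by
  rw [← hasSum_nat_add_iff' 1]
  simpa [shiftSeq] using hasSum_norm_sq f

variable (Y) in
/-- The forward shift `f ↦ z f`. -/
def shift : H2 Y →ₗᵢ[ℂ] H2 Y where
  toFun f := ofCoeffs ⟨shiftSeq f.coeff, memℓp_two (hasSum_shiftSeq f).summable⟩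
  map_add' f g := ext_coeff fun n => by
    rw [coeff_add]
    simp only [coeff_ofCoeffs]
    cases n <;> simp [shiftSeq, coeff_add]
  map_smul' c f := ext_coeff fun n => by
    rw [RingHom.id_apply, coeff_smul]
    simp only [coeff_ofCoeffs]
    cases n <;> simp [shiftSeq, coeff_smul]
  norm_map' f := by
    rw [← sq_eq_sq₀ (norm_nonneg _) (norm_nonneg _)]
    refine (hasSum_norm_sq _).unique ?_
    simpa only [LinearMap.coe_mk, AddHom.coe_mk, coeff_ofCoeffs] using hasSum_shiftSeq f

@[simp]
theorem coeff_shift_zero (f : H2 Y) : (shift Y f).coeff 0 = 0 :=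
  coeff_ofCoeffs _ 0

@[simp]
theorem coeff_shift_succ (f : H2 Y) (n : ℕ) : (shift Y f).coeff (n + 1) = f.coeff n :=
  coeff_ofCoeffs _ (n + 1)

@[simp]
theorem shift_apply (f : H2 Y) (z : 𝔻) : shift Y f z = (z : ℂ) • f z := by
  refine (hasSum_coeff _ z).unique ?_
  rw [← hasSum_nat_add_iff' 1]
  simpa [pow_succ', mul_smul] using (hasSum_coeff f z).const_smul (z : ℂ)

theorem exists_eq_const_add_shift (f : H2 Y) :
    ∃ g, f = const Y (f.coeff 0) + shift Y g := by
  refine ⟨ofCoeffs ⟨fun n => f.coeff (n + 1),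
    memℓp_two ((summable_nat_add_iff 1).2 (hasSum_norm_sq f).summable)⟩, ext_coeff fun n => ?_⟩
  rw [coeff_add]
  cases n <;> simp

theorem inner_const_shift (y : Y) (f : H2 Y) : ⟪const Y y, shift Y f⟫_ℂ = 0 := by
  simp [inner_const_left]

theorem eq_const_of_orthogonal {f : H2 Y} (h : ∀ g, ⟪f, shift Y g⟫_ℂ = 0) :
    f = const Y (f.coeff 0) := by
  obtain ⟨g, hg⟩ := exists_eq_const_add_shift f
  have h1 := h g
  have : ⟪shift Y g, shift Y g⟫_ℂ = 0 := by
    rw [hg, inner_add_left, inner_const_shift, zero_add] at h1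
    exact h1
  rw [inner_self_eq_zero] at this
  rwa [this, add_zero] at hg

variable (Y) in
/-- The backward shift, the adjoint of the forward shift. -/
def backShift : H2 Y →L[ℂ] H2 Y := (shift Y).toContinuousLinearMap.adjoint

theorem inner_backShift_left (f g : H2 Y) : ⟪backShift Y f, g⟫_ℂ = ⟪f, shift Y g⟫_ℂ :=
  ContinuousLinearMap.adjoint_inner_left _ _ _

theorem backShift_const_add_shift (y : Y) (g : H2 Y) :
    backShift Y (const Y y + shift Y g) = g := by
  refine ext_inner_right ℂ fun k => ?_
  rw [inner_backShift_left, inner_add_left, inner_const_shift, zero_add,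
    LinearIsometry.inner_map_map]

theorem const_add_shift_backShift (f : H2 Y) :
    const Y (f.coeff 0) + shift Y (backShift Y f) = f := by
  obtain ⟨g, hg⟩ := exists_eq_const_add_shift f
  nth_rw 2 [hg]
  rw [backShift_const_add_shift, ← hg]

theorem coeff_backShift (f : H2 Y) (n : ℕ) : (backShift Y f).coeff n = f.coeff (n + 1) := by
  conv_rhs => rw [← const_add_shift_backShift f]
  simp [coeff_add]

theorem norm_backShift_le (f : H2 Y) : ‖backShift Y f‖ ≤ ‖f‖ := by
  have h := (ContinuousLinearMap.adjoint (shift Y).toContinuousLinearMap).le_opNorm f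
  rw [LinearIsometryEquiv.norm_map] at h
  exact h.trans (mul_le_of_le_one_left (norm_nonneg _)
    (LinearIsometry.norm_toContinuousLinearMap_le _))

theorem inner_shift_iterate_const (g : H2 Y) (n : ℕ) (y : Y) :
    ⟪g, (shift Y)^[n] (const Y y)⟫_ℂ = ⟪g.coeff n, y⟫_ℂ := by
  induction n generalizing g with
  | zero => rw [Function.iterate_zero_apply, ← inner_conj_symm, inner_const_left, inner_conj_symm]
  | succ n ih => rw [Function.iterate_succ_apply', ← inner_backShift_left, ih, coeff_backShift]

theorem norm_shift_iterate (n : ℕ) (f : H2 Y) : ‖(shift Y)^[n] f‖ = ‖f‖ := by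
  induction n with
  | zero => rfl
  | succ n ih => rw [Function.iterate_succ_apply', LinearIsometry.norm_map, ih]

theorem inner_shift_iterate (n : ℕ) (f g : H2 Y) :
    ⟪(shift Y)^[n] f, (shift Y)^[n] g⟫_ℂ = ⟪f, g⟫_ℂ := by
  induction n with
  | zero => rfl
  | succ n ih => rw [Function.iterate_succ_apply', Function.iterate_succ_apply',
      LinearIsometry.inner_map_map, ih]

theorem shift_iterate_apply (n : ℕ) (f : H2 Y) (z : 𝔻) :
    ((shift Y)^[n] f) z = (z : ℂ) ^ n • f z := by
  induction n with
  | zero => simp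
  | succ n ih => rw [Function.iterate_succ_apply', shift_apply, ih, smul_smul, pow_succ']

theorem coeff_shift_iterate_of_lt {n m : ℕ} (h : m < n) (f : H2 Y) :
    ((shift Y)^[n] f).coeff m = 0 := by
  induction n generalizing m with
  | zero => omega
  | succ n ih =>
    rw [Function.iterate_succ_apply']
    cases m with
    | zero => simp
    | succ m => rw [coeff_shift_succ, ih (by omega)]

/-- The value at `z` of the reproducing kernel function of `H²_Y` at `ζ`. -/
theorem eval_comp_adjoint_eval (z ζ : 𝔻) :
    eval Y z ∘L (eval Y ζ).adjoint = (1 - (z : ℂ) * conj (ζ : ℂ))⁻¹ • 1 := by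
  have hne : 1 - (z : ℂ) * conj (ζ : ℂ) ≠ 0 := by
    intro h
    have h1 : ‖(z : ℂ) * conj (ζ : ℂ)‖ = 1 := by rw [← sub_eq_zero.1 h, norm_one]
    rw [norm_mul, RCLike.norm_conj] at h1
    nlinarith [z.norm_lt_one, ζ.norm_lt_one, norm_nonneg (z : ℂ), norm_nonneg (ζ : ℂ)]
  ext y
  -- The kernel function `k` is determined by `k₀ = y` and `S* k = ζ̄ k`. Substituting these into `k
  -- = k₀ + S S* k` gives a scalar equation for `k z`.
  set k := (eval Y ζ).adjoint y with hk
  have h0 : k.coeff 0 = y := by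
    refine ext_inner_left ℂ fun y' => ?_
    rw [← inner_const_left, hk, ContinuousLinearMap.adjoint_inner_right, eval_apply, const_apply]
  have h1 : backShift Y k = conj (ζ : ℂ) • k := by
    refine ext_inner_right ℂ fun g => ?_
    rw [inner_backShift_left, inner_smul_left, Complex.conj_conj, hk,
      ContinuousLinearMap.adjoint_inner_left, ContinuousLinearMap.adjoint_inner_left, eval_apply,
      shift_apply, inner_smul_right, eval_apply]
  have h2 : k z = y + ((z : ℂ) * conj (ζ : ℂ)) • k z := by
    conv_lhs => rw [← const_add_shift_backShift k, h0, h1]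
    rw [add_apply, const_apply, shift_apply, mul_smul]
    rfl
  change k z = (1 - (z : ℂ) * conj (ζ : ℂ))⁻¹ • y
  rw [eq_inv_smul_iff₀ hne, sub_smul, one_smul]
  exact sub_eq_of_eq_add h2

/-- Totality of the kernel functions, used on both sides: `A` kills each of them, so every value of
`A* f` is orthogonal to all of `Y`. -/
theorem eq_zero_of_eval_comp_comp_adjoint_eval {A : H2 Y →L[ℂ] H2 Y}
    (h : ∀ z ζ : 𝔻, eval Y z ∘L A ∘L (eval Y ζ).adjoint = 0) : A = 0 := by
  have h1 : ∀ ζ y, A ((eval Y ζ).adjoint y) = 0 := fun ζ y =>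
    ext_apply fun z => DFunLike.congr_fun (h z ζ) y
  have h2 : A.adjoint = 0 := by
    ext1 f
    refine ext_apply fun ζ => ext_inner_right ℂ fun y => ?_
    change ⟪eval Y ζ (A.adjoint f), y⟫_ℂ = ⟪(0 : Y), y⟫_ℂ
    rw [← ContinuousLinearMap.adjoint_inner_right, ContinuousLinearMap.adjoint_inner_left, h1,
      inner_zero_right, inner_zero_left]
  simpa using h2

end H2

/-! ### Multiplication operators and the contractivity of their symbols. -/

section Multiplication

variable {U Y : Type*} [NormedAddCommGroup U] [InnerProductSpace ℂ U] [CompleteSpace U]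
  [NormedAddCommGroup Y] [InnerProductSpace ℂ Y] [CompleteSpace Y]

theorem H2.norm_adjoint_eval_sq (z : 𝔻) (y : Y) :
    ‖(H2.eval Y z).adjoint y‖ ^ 2 = (1 - ‖(z : ℂ)‖ ^ 2)⁻¹ * ‖y‖ ^ 2 := by
  have h := DFunLike.congr_fun (H2.eval_comp_adjoint_eval (Y := Y) z z) y
  have hc : (1 - (z : ℂ) * conj (z : ℂ))⁻¹ = (((1 - ‖(z : ℂ)‖ ^ 2)⁻¹ : ℝ) : ℂ) := by
    rw [Complex.mul_conj, Complex.normSq_eq_norm_sq]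
    push_cast
    rfl
  rw [hc] at h
  have h2 : ⟪(H2.eval Y z).adjoint y, (H2.eval Y z).adjoint y⟫_ℂ =
      ((((1 - ‖(z : ℂ)‖ ^ 2)⁻¹ * ‖y‖ ^ 2 : ℝ)) : ℂ) := by
    rw [ContinuousLinearMap.adjoint_inner_right]
    change ⟪(H2.eval Y z ∘L (H2.eval Y z).adjoint) y, y⟫_ℂ = _
    rw [h]
    change ⟪(((1 - ‖(z : ℂ)‖ ^ 2)⁻¹ : ℝ) : ℂ) • y, y⟫_ℂ = _
    rw [inner_smul_left, Complex.conj_ofReal, inner_self_eq_norm_sq_to_K]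
    push_cast
    rfl
  rw [inner_self_eq_norm_sq_to_K] at h2
  refine Complex.ofReal_injective (Eq.trans ?_ h2)
  push_cast
  rfl

/-- The values of a contractive multiplier are contractions. -/
theorem norm_le_one_of_eval_comp {L : H2 U →L[ℂ] H2 Y} (hL : ‖L‖ ≤ 1) {b : U →L[ℂ] Y} {z : 𝔻}
    (h : H2.eval Y z ∘L L = b ∘L H2.eval U z) : ‖b‖ ≤ 1 := by
  rw [← LinearIsometryEquiv.norm_map ContinuousLinearMap.adjoint b]
  refine ContinuousLinearMap.opNorm_le_bound _ zero_le_one fun y => ?_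
  -- `L*` sends the kernel function at `z` in direction `y` to the one in direction `b* y`. Both
  -- squared norms carry the same factor `(1 - |z|²)⁻¹`, which cancels.
  have h1 := congrArg ContinuousLinearMap.adjoint h
  rw [ContinuousLinearMap.adjoint_comp, ContinuousLinearMap.adjoint_comp] at h1
  have h2 := DFunLike.congr_fun h1 y
  have h3 : ‖(H2.eval U z).adjoint (b.adjoint y)‖ ≤ ‖(H2.eval Y z).adjoint y‖ := by
    refine (congrArg norm h2).symm.le.trans ((L.adjoint.le_opNorm _).trans ?_)
    rw [LinearIsometryEquiv.norm_map]
    exact mul_le_of_le_one_left (norm_nonneg _) hL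
  have hz : 0 < 1 - ‖(z : ℂ)‖ ^ 2 := by
    nlinarith [z.norm_lt_one, norm_nonneg (z : ℂ)]
  have h4 := pow_le_pow_left₀ (norm_nonneg _) h3 2
  rw [H2.norm_adjoint_eval_sq, H2.norm_adjoint_eval_sq] at h4
  rw [one_mul]
  exact le_of_sq_le_sq (le_of_mul_le_mul_left h4 (inv_pos.2 hz)) (norm_nonneg _)

/-- Multiplication by an inner function as an isometry. -/
theorem IsInner.exists_linearIsometry {B : ℂ → U →L[ℂ] Y} (hB : IsInner B) :
    ∃ L : H2 U →ₗᵢ[ℂ] H2 Y, ∀ h (z : 𝔻), L h z = B z (h z) := by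
  choose L hL hn using hB.2
  refine ⟨⟨⟨⟨L, fun f g => H2.ext_apply fun z => ?_⟩, fun c f => H2.ext_apply fun z => ?_⟩, hn⟩, hL⟩
  · rw [H2.add_apply, hL, hL, hL, H2.add_apply, map_add]
  · change L (c • f) z = c • L f z
    rw [hL, hL, ← map_smul]
    rfl

end Multiplication

/-! ### Analytic operator functions built from isometries into the Hardy space. -/

section Symbol

variable {U Y : Type*} [NormedAddCommGroup U] [InnerProductSpace ℂ U]
  [NormedAddCommGroup Y] [InnerProductSpace ℂ Y] [CompleteSpace Y]

/-- The power series with the operator coefficients `u ↦ (e u)ₙ`. -/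
def symbolSeries (e : U →ₗᵢ[ℂ] H2 Y) : FormalMultilinearSeries ℂ ℂ (U →L[ℂ] Y) := fun n =>
  ContinuousMultilinearMap.mkPiRing ℂ (Fin n) (H2.coeffL Y n ∘L e.toContinuousLinearMap)

/-- The operator function `z ↦ (u ↦ (e u) z)` on the unit disc. -/
def symbol (e : U →ₗᵢ[ℂ] H2 Y) (z : ℂ) : U →L[ℂ] Y := (symbolSeries e).sum z

theorem norm_symbolSeries_le (e : U →ₗᵢ[ℂ] H2 Y) (n : ℕ) : ‖symbolSeries e n‖ ≤ 1 := by
  rw [symbolSeries, ContinuousMultilinearMap.norm_mkPiRing]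
  refine (ContinuousLinearMap.opNorm_comp_le _ _).trans ?_
  exact mul_le_one₀ (H2.norm_coeffL_le n) (norm_nonneg _)
    (LinearIsometry.norm_toContinuousLinearMap_le _)

theorem one_le_radius_symbolSeries (e : U →ₗᵢ[ℂ] H2 Y) : 1 ≤ (symbolSeries e).radius := by
  have h := (symbolSeries e).le_radius_of_bound (r := 1) 1 fun n => by
    simpa using norm_symbolSeries_le e n
  simpa using h

theorem hasFPowerSeriesOnBall_symbol (e : U →ₗᵢ[ℂ] H2 Y) :
    HasFPowerSeriesOnBall (symbol e) (symbolSeries e) 0 1 :=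
  ((symbolSeries e).hasFPowerSeriesOnBall
    (zero_lt_one.trans_le (one_le_radius_symbolSeries e))).mono zero_lt_one
    (one_le_radius_symbolSeries e)

theorem differentiableOn_symbol (e : U →ₗᵢ[ℂ] H2 Y) :
    DifferentiableOn ℂ (symbol e) (Metric.ball 0 1) := by
  have h := (hasFPowerSeriesOnBall_symbol e).differentiableOn
  rwa [← ENNReal.ofReal_one, Metric.eball_ofReal] at h

theorem symbol_apply (e : U →ₗᵢ[ℂ] H2 Y) (z : 𝔻) (u : U) : symbol e z u = e u z := by
  have h := (hasFPowerSeriesOnBall_symbol e).hasSum (y := (z : ℂ)) (by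
    rw [← ENNReal.ofReal_one, Metric.eball_ofReal]
    simpa using z.norm_lt_one)
  rw [zero_add] at h
  have h1 := h.mapL (ContinuousLinearMap.apply ℂ Y u)
  refine h1.unique ?_
  convert H2.hasSum_coeff (e u) z using 2 with n
  simp [symbolSeries]

end Symbol

/-! ### Wandering subspaces and the Beurling–Lax theorem. -/

section BeurlingLax

variable {Y : Type*} [NormedAddCommGroup Y] [InnerProductSpace ℂ Y] [CompleteSpace Y]

/-- A subspace of `H²_Y` is wandering if it is orthogonal to its proper shifts. -/
def IsWandering (W : Submodule ℂ (H2 Y)) : Prop :=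
  ∀ w ∈ W, ∀ w' ∈ W, ∀ n : ℕ, ⟪w, (H2.shift Y)^[n + 1] w'⟫_ℂ = 0

theorem IsWandering.inner_iterate {W : Submodule ℂ (H2 Y)} (hW : IsWandering W) {w w' : H2 Y}
    (hw : w ∈ W) (hw' : w' ∈ W) {n m : ℕ} (hnm : n ≠ m) :
    ⟪(H2.shift Y)^[n] w, (H2.shift Y)^[m] w'⟫_ℂ = 0 := by
  wlog h : n < m generalizing n m w w'
  · rw [← inner_conj_symm, this hw' hw hnm.symm (by omega), map_zero]
  obtain ⟨k, rfl⟩ := Nat.exists_eq_add_of_lt h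
  rw [add_assoc, Function.iterate_add_apply, H2.inner_shift_iterate]
  exact hW w hw w' hw' k

theorem IsWandering.orthonormal {W : Submodule ℂ (H2 Y)} (hW : IsWandering W) {ι : Type*}
    {v : ι → W} (hv : Orthonormal ℂ v) :
    Orthonormal ℂ fun p : ι × ℕ => (H2.shift Y)^[p.2] (v p.1 : H2 Y) := by
  refine ⟨fun p => (H2.norm_shift_iterate _ _).trans (hv.1 p.1), ?_⟩
  rintro ⟨i, n⟩ ⟨j, m⟩ hne
  by_cases hnm : n = m
  · subst hnm
    have hij : i ≠ j := fun h => hne (by rw [h])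
    exact (H2.inner_shift_iterate n _ _).trans (hv.2 hij)
  · exact hW.inner_iterate (v i).2 (v j).2 hnm

/-- Bessel's inequality for the orthonormal family `Sⁿ vᵢ` tested on `S^(N-1) y`, a vector of norm
`‖y‖`. Pairing with `Sⁿ vᵢ` picks out the coefficient of index `N - 1 - n`, so the sum over `n`
appears reversed. -/
theorem IsWandering.sum_norm_inner_coeff_le {W : Submodule ℂ (H2 Y)} (hW : IsWandering W)
    {ι : Type*} {v : ι → W} (hv : Orthonormal ℂ v) (s : Finset ι) (N : ℕ) (y : Y) :
    ∑ i ∈ s, ∑ n ∈ Finset.range N, ‖⟪(v i : H2 Y).coeff n, y⟫_ℂ‖ ^ 2 ≤ ‖y‖ ^ 2 := by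
  -- For `N = 0` the truncated `N - 1` is harmless, since the range is empty.
  have h := (hW.orthonormal hv).sum_inner_products_le
    ((H2.shift Y)^[N - 1] (H2.const Y y)) (s := s ×ˢ Finset.range N)
  rw [H2.norm_shift_iterate, LinearIsometry.norm_map, Finset.sum_product] at h
  refine le_of_eq_of_le (Finset.sum_congr rfl fun i _ => ?_) h
  rw [← Finset.sum_range_reflect]
  refine Finset.sum_congr rfl fun n hn => ?_
  have hn' : n ≤ N - 1 := by have := Finset.mem_range.1 hn; omega
  conv_rhs => rw [show N - 1 = n + (N - 1 - n) by omega, Function.iterate_add_apply]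
  rw [H2.inner_shift_iterate, H2.inner_shift_iterate_const]

/-- Summing the Bessel bound over an orthonormal basis of `Y` bounds the truncated norms by `dim Y`.
As `N → ∞` they tend to `∑ ‖vᵢ‖²`, the number of vectors. -/
theorem IsWandering.card_le {W : Submodule ℂ (H2 Y)} (hW : IsWandering W)
    {ι : Type*} {v : ι → W} (hv : Orthonormal ℂ v) {κ : Type*} [Fintype κ]
    (c : OrthonormalBasis κ ℂ Y) (s : Finset ι) : s.card ≤ Fintype.card κ := by
  have h1 : ∀ N, ∑ i ∈ s, ∑ n ∈ Finset.range N, ‖(v i : H2 Y).coeff n‖ ^ 2 ≤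
      (Fintype.card κ : ℝ) := fun N => by
    calc ∑ i ∈ s, ∑ n ∈ Finset.range N, ‖(v i : H2 Y).coeff n‖ ^ 2
        = ∑ i ∈ s, ∑ n ∈ Finset.range N, ∑ k, ‖⟪(v i : H2 Y).coeff n, c k⟫_ℂ‖ ^ 2 := by
          simp only [c.sum_sq_norm_inner_left]
      _ = ∑ i ∈ s, ∑ k, ∑ n ∈ Finset.range N, ‖⟪(v i : H2 Y).coeff n, c k⟫_ℂ‖ ^ 2 :=
          Finset.sum_congr rfl fun _ _ => Finset.sum_comm
      _ = ∑ k, ∑ i ∈ s, ∑ n ∈ Finset.range N, ‖⟪(v i : H2 Y).coeff n, c k⟫_ℂ‖ ^ 2 :=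
          Finset.sum_comm
      _ ≤ ∑ k : κ, (1 : ℝ) := by
          refine Finset.sum_le_sum fun k _ => ?_
          refine (hW.sum_norm_inner_coeff_le hv s N (c k)).trans_eq ?_
          rw [c.orthonormal.1, one_pow]
      _ = Fintype.card κ := by simp
  have h2 : Filter.Tendsto (fun N => ∑ i ∈ s, ∑ n ∈ Finset.range N, ‖(v i : H2 Y).coeff n‖ ^ 2)
      Filter.atTop (nhds (∑ i ∈ s, (1 : ℝ))) := by
    refine tendsto_finsetSum _ fun i _ => ?_
    have h3 := (H2.hasSum_norm_sq (v i : H2 Y)).tendsto_sum_nat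
    have h4 : ‖(v i : H2 Y)‖ = 1 := hv.1 i
    rwa [h4, one_pow] at h3
  have h5 := le_of_tendsto' h2 h1
  simpa using h5

theorem IsWandering.countable_inner_coeff_ne_zero {W : Submodule ℂ (H2 Y)} (hW : IsWandering W)
    {ι : Type*} {v : ι → W} (hv : Orthonormal ℂ v) (n : ℕ) (y : Y) :
    {i | ⟪(v i : H2 Y).coeff n, y⟫_ℂ ≠ 0}.Countable := by
  have h : Summable fun i => ‖⟪(v i : H2 Y).coeff n, y⟫_ℂ‖ ^ 2 := by
    refine summable_of_sum_le (c := ‖y‖ ^ 2) (fun i => sq_nonneg _) fun s => ?_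
    refine le_trans (Finset.sum_le_sum fun i _ => ?_)
      (hW.sum_norm_inner_coeff_le hv s (n + 1) y)
    exact Finset.single_le_sum (f := fun n => ‖⟪(v i : H2 Y).coeff n, y⟫_ℂ‖ ^ 2)
      (fun _ _ => sq_nonneg _) (Finset.self_mem_range_succ n)
  refine h.countable_support.mono fun i hi => ?_
  simpa using hi

/-- The Hilbert space dimension of a wandering subspace of `H²_Y` is at most that of `Y`. -/
theorem IsWandering.nonempty_linearIsometry {W : Submodule ℂ (H2 Y)} [CompleteSpace W]
    (hW : IsWandering W) : Nonempty (W →ₗᵢ[ℂ] Y) := by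
  obtain ⟨I, b, -⟩ := exists_hilbertBasis ℂ W
  obtain ⟨J, c, -⟩ := exists_hilbertBasis ℂ Y
  have hcard : Cardinal.mk I ≤ Cardinal.mk J := by
    rcases finite_or_infinite J with hJ | hJ
    · have := Fintype.ofFinite J
      rw [Cardinal.mk_fintype J]
      exact Cardinal.card_le_of fun s => hW.card_le b.orthonormal c.toOrthonormalBasis s
    -- In infinite dimension, each basis vector of `W` is sent to a position `(n, j)` where it has a
    -- nonzero scalar coefficient. The fibres are countable, so `|I| ≤ ℵ₀ · |J| · ℵ₀ = |J|`. The
    -- `ULift` only aligns universes.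
    · have hex : ∀ i, ∃ p : ULift.{_, 0} ℕ × J, ⟪(b i : H2 Y).coeff p.1.down, c p.2⟫_ℂ ≠ 0 := by
        intro i
        by_contra! h
        have hi : (b i : H2 Y) = 0 := H2.ext_coeff fun n => by
          rw [H2.coeff_zero]
          refine c.repr.injective ?_
          ext j
          rw [c.repr_apply_apply, ← inner_conj_symm, h (⟨n⟩, j), map_zero, map_zero]
          rfl
        have h1 := b.orthonormal.1 i
        rw [Submodule.coe_norm, hi, norm_zero] at h1
        exact zero_ne_one h1
      choose φ hφ using hex
      refine (Cardinal.mk_le_mk_mul_of_mk_preimage_le (c := Cardinal.aleph0) φ fun p => ?_).trans ?_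
      · refine (Cardinal.le_aleph0_iff_set_countable).2 ?_
        refine (hW.countable_inner_coeff_ne_zero b.orthonormal p.1.down (c p.2)).mono ?_
        rintro i rfl
        exact hφ i
      · have hJ' := Cardinal.aleph0_le_mk J
        rw [Cardinal.mk_prod, Cardinal.lift_id, Cardinal.lift_id, Cardinal.mk_uLift,
          Cardinal.mk_nat, Cardinal.lift_aleph0, Cardinal.aleph0_mul_eq hJ',
          Cardinal.mul_aleph0_eq hJ']
  obtain ⟨φ⟩ := hcard
  have hφ := (c.orthonormal.comp φ φ.injective).orthogonalFamily
  exact ⟨hφ.linearIsometry.comp b.repr.toLinearIsometry⟩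

/-- The part of `M` orthogonal to `zM`. -/
def wanderingPart (M : Submodule ℂ (H2 Y)) : Submodule ℂ (H2 Y) :=
  M ⊓ (M.map (H2.shift Y).toLinearMap)ᗮ

theorem isWandering_wanderingPart {M : Submodule ℂ (H2 Y)} (hM : ∀ f ∈ M, H2.shift Y f ∈ M) :
    IsWandering (wanderingPart M) := by
  intro w hw w' hw' n
  have hn : (H2.shift Y)^[n] w' ∈ M := by
    induction n with
    | zero => exact hw'.1
    | succ n ih => rw [Function.iterate_succ_apply']; exact hM _ ih
  rw [Function.iterate_succ_apply', ← inner_conj_symm]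
  exact (congrArg _ ((Submodule.mem_orthogonal _ _).1 hw.2 _ ⟨_, hn, rfl⟩)).trans (map_zero _)

/-- `S` is isometric, so `S M` is closed and `f` splits along it. The component orthogonal to `S M`
lies in the wandering part, hence is orthogonal to `f` and vanishes. -/
theorem exists_eq_shift_of_orthogonal_wanderingPart {M : Submodule ℂ (H2 Y)} [CompleteSpace M]
    (hM : ∀ f ∈ M, H2.shift Y f ∈ M) {f : H2 Y} (hf : f ∈ M)
    (h : ∀ w ∈ wanderingPart M, ⟪w, f⟫_ℂ = 0) : ∃ g ∈ M, f = H2.shift Y g := by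
  have hcl : IsComplete ((M.map (H2.shift Y).toLinearMap : Submodule ℂ (H2 Y)) : Set (H2 Y)) := by
    rw [Submodule.map_coe]
    exact (H2.shift Y).isometry.isUniformInducing.isComplete_iff.2
      (completeSpace_coe_iff_isComplete.1 ‹_›)
  have : CompleteSpace (M.map (H2.shift Y).toLinearMap : Submodule ℂ (H2 Y)) :=
    hcl.completeSpace_coe
  obtain ⟨p, ⟨g, hg, rfl⟩, q, hq, hpq⟩ :=
    (M.map (H2.shift Y).toLinearMap).exists_add_mem_mem_orthogonal f
  have hqM : q ∈ M := by
    rw [← sub_eq_of_eq_add' hpq]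
    exact M.sub_mem hf (hM g hg)
  have h0 := h q ⟨hqM, hq⟩
  rw [hpq, inner_add_right, ← inner_conj_symm,
    (Submodule.mem_orthogonal _ _).1 hq _ ⟨g, hg, rfl⟩, map_zero, zero_add,
    inner_self_eq_zero] at h0
  exact ⟨g, hg, by rw [hpq, h0, add_zero]; rfl⟩

/-- Repeatedly dividing by `S` puts `f` in `Sⁿ M` for every `n`, and a function in the range of
every `Sⁿ` has no nonzero Taylor coefficient. -/
theorem eq_zero_of_orthogonal_wanderingPart {M : Submodule ℂ (H2 Y)} [CompleteSpace M]
    (hM : ∀ f ∈ M, H2.shift Y f ∈ M) {f : H2 Y} (hf : f ∈ M)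
    (h : ∀ w ∈ wanderingPart M, ∀ n, ⟪(H2.shift Y)^[n] w, f⟫_ℂ = 0) : f = 0 := by
  have key : ∀ n, ∃ g ∈ M, f = (H2.shift Y)^[n] g := by
    intro n
    induction n with
    | zero => exact ⟨f, hf, rfl⟩
    | succ n ih =>
      obtain ⟨g, hg, rfl⟩ := ih
      obtain ⟨g', hg', rfl⟩ := exists_eq_shift_of_orthogonal_wanderingPart hM hg fun w hw => by
        rw [← h w hw n, H2.inner_shift_iterate]
      exact ⟨g', hg', (Function.iterate_succ_apply _ _ _).symm⟩
  refine H2.ext_coeff fun n => ?_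
  obtain ⟨g, -, rfl⟩ := key (n + 1)
  rw [H2.coeff_shift_iterate_of_lt n.lt_succ_self, H2.coeff_zero]

/-- **Beurling–Lax theorem**: a closed shift-invariant subspace of `H²_Y` is the range of
multiplication by an inner function, whose coefficient space is a closed subspace of `Y`. -/
theorem exists_isInner_of_shift_invariant (M : Submodule ℂ (H2 Y)) [CompleteSpace M]
    (hM : ∀ f ∈ M, H2.shift Y f ∈ M) :
    ∃ (Y₀ : Submodule ℂ Y) (_ : CompleteSpace Y₀) (B : ℂ → Y₀ →L[ℂ] Y), IsInner B ∧
      ∃ L : H2 Y₀ →ₗᵢ[ℂ] H2 Y, (∀ h (z : 𝔻), L h z = B z (h z)) ∧ ∀ f, f ∈ M ↔ ∃ h, L h = f := by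
  set W := wanderingPart M
  have hW : IsWandering W := isWandering_wanderingPart hM
  have hWc : CompleteSpace W := by
    have hc : IsClosed (W : Set (H2 Y)) :=
      (completeSpace_coe_iff_isComplete.1 ‹CompleteSpace M›).isClosed.inter
        (Submodule.isClosed_orthogonal _)
    exact hc.completeSpace_coe
  obtain ⟨φ⟩ := hW.nonempty_linearIsometry
  obtain ⟨e⟩ : Nonempty (W ≃ₗᵢ[ℂ] LinearMap.range φ.toLinearMap) := ⟨φ.equivRange⟩
  have hY₀ : CompleteSpace (LinearMap.range φ.toLinearMap) :=
    e.symm.toIsometryEquiv.completeSpace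
  refine ⟨LinearMap.range φ.toLinearMap, hY₀, ?_⟩
  -- From here on only the isometry between `W` and the coefficient space matters.
  generalize LinearMap.range φ.toLinearMap = Y₀ at e hY₀
  let ι : Y₀ →ₗᵢ[ℂ] H2 Y := W.subtypeₗᵢ.comp e.symm.toLinearIsometry
  have hι : ∀ u, ι u ∈ W := fun u => (e.symm u).2
  let V : ℕ → Y₀ →ₗᵢ[ℂ] H2 Y := fun n => (H2.shift Y ^ n).comp ι
  have hV : ∀ n u, V n u = (H2.shift Y)^[n] (ι u) := fun n u => by
    rw [← LinearIsometry.coe_pow]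
    rfl
  -- The spaces `Sⁿ W` are mutually orthogonal, so `h ↦ ∑ Sⁿ ι hₙ` is an isometry. Evaluated at `z`
  -- it is multiplication by `symbol ι z`.
  have hVo : OrthogonalFamily ℂ (fun _ : ℕ => Y₀) V := fun n m hnm u u' => by
    simp only [hV]
    exact hW.inner_iterate (hι u) (hι u') hnm
  let L : H2 Y₀ →ₗᵢ[ℂ] H2 Y :=
    hVo.linearIsometry.comp (H2.taylorIsometry Y₀).toLinearIsometry
  have hLs : ∀ h, HasSum (fun n => (H2.shift Y)^[n] (ι (h.coeff n))) (L h) := fun h => by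
    have := hVo.hasSum_linearIsometry (H2.taylorIsometry Y₀ h)
    simp only [hV] at this
    exact this
  have hL : ∀ h (z : 𝔻), L h z = symbol ι z (h z) := fun h z => by
    have h1 := (hLs h).mapL (H2.eval Y z)
    have h2 := (H2.hasSum_coeff h z).mapL (symbol ι z)
    refine h1.unique ?_
    convert! h2 using 2 with n
    rw [H2.eval_apply, H2.shift_iterate_apply, map_smul, symbol_apply]
  refine ⟨symbol ι, ⟨⟨differentiableOn_symbol ι, fun z hz => ?_⟩, fun h =>
    ⟨L h, hL h, L.norm_map h⟩⟩, L, hL, ?_⟩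
  · have hz' : ‖z‖ < 1 := by simpa using hz
    refine norm_le_one_of_eval_comp (z := Complex.UnitDisc.mk z hz')
      (LinearIsometry.norm_toContinuousLinearMap_le L) ?_
    ext h
    exact hL h _
  · have hrange : ∀ h, L h ∈ M := fun h => by
      refine (completeSpace_coe_iff_isComplete.1 ‹CompleteSpace M›).isClosed.mem_of_tendsto
        (hLs h) (Filter.Eventually.of_forall fun s => M.sum_mem fun n _ => ?_)
      have hn : ∀ n, ∀ f ∈ M, (H2.shift Y)^[n] f ∈ M := fun n => by
        induction n with
        | zero => exact fun f hf => hf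
        | succ n ih => exact fun f hf => ih _ (hM f hf)
      exact hn n _ (hι _).1
    have hmono : ∀ n, ∀ w ∈ W, ∃ h, L h = (H2.shift Y)^[n] w := fun n w hw => by
      refine ⟨H2.ofCoeffs (lp.single 2 n (e ⟨w, hw⟩)), ?_⟩
      have h1 : L (H2.ofCoeffs (lp.single 2 n (e ⟨w, hw⟩))) =
          hVo.linearIsometry (lp.single 2 n (e ⟨w, hw⟩)) :=
        congrArg hVo.linearIsometry ((H2.taylorIsometry Y₀).apply_symm_apply _)
      rw [h1, hVo.linearIsometry_apply_single, hV]
      simp [ι]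
    refine fun f => ⟨fun hf => ?_, ?_⟩
    · have : CompleteSpace (LinearMap.range L.toLinearMap) :=
        L.equivRange.symm.toIsometryEquiv.completeSpace
      obtain ⟨p, ⟨h, rfl⟩, q, hq, hpq⟩ :=
        (LinearMap.range L.toLinearMap).exists_add_mem_mem_orthogonal f
      refine ⟨h, ?_⟩
      -- The range of `L` contains every `Sⁿ W`, so the component of `f` orthogonal to that range is
      -- orthogonal to all of them.
      have hq0 : q = 0 := by
        refine eq_zero_of_orthogonal_wanderingPart hM ?_ fun w hw n => ?_
        · rw [← sub_eq_of_eq_add' hpq]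
          exact M.sub_mem hf (hrange h)
        · obtain ⟨k, hk⟩ := hmono n w hw
          rw [← hk]
          exact (Submodule.mem_orthogonal _ _).1 hq _ ⟨k, rfl⟩
      rw [hpq, hq0, add_zero]
      rfl
    · rintro ⟨h, rfl⟩
      exact hrange h

end BeurlingLax

/-! ### The de Branges–Rovnyak kernel as a compressed operator. -/

section Kernel

variable {U Y : Type*} [NormedAddCommGroup U] [InnerProductSpace ℂ U] [CompleteSpace U]
  [NormedAddCommGroup Y] [InnerProductSpace ℂ Y] [CompleteSpace Y]
  {B : ℂ → U →L[ℂ] Y} {L : H2 U →ₗᵢ[ℂ] H2 Y}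

/-- The intertwining `eval z ∘ L = B z ∘ eval z` and its adjoint move `L L*` past the evaluations,
leaving the scalar reproducing kernel between `B z` and `(B ζ)*`. -/
theorem dBRKernel_eq (hL : ∀ g (z : 𝔻), L g z = B z (g z)) (z ζ : 𝔻) :
    dBRKernel B z ζ = H2.eval Y z ∘L
      (1 - L.toContinuousLinearMap ∘L L.toContinuousLinearMap.adjoint) ∘L
        (H2.eval Y ζ).adjoint := by
  have h1 : ∀ z : 𝔻, H2.eval Y z ∘L L.toContinuousLinearMap = B z ∘L H2.eval U z := fun z => by
    ext g
    exact hL g z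
  have h2 := congrArg ContinuousLinearMap.adjoint (h1 ζ)
  rw [ContinuousLinearMap.adjoint_comp, ContinuousLinearMap.adjoint_comp] at h2
  have h3 : H2.eval Y z ∘L (L.toContinuousLinearMap ∘L L.toContinuousLinearMap.adjoint) ∘L
        (H2.eval Y ζ).adjoint = (1 - (z : ℂ) * conj (ζ : ℂ))⁻¹ • (B z ∘L (B ζ).adjoint) := by
    calc _ = (H2.eval Y z ∘L L.toContinuousLinearMap) ∘L
          (L.toContinuousLinearMap.adjoint ∘L (H2.eval Y ζ).adjoint) := rfl
      _ = B z ∘L (H2.eval U z ∘L (H2.eval U ζ).adjoint) ∘L (B ζ).adjoint := by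
        rw [h1, h2]
        rfl
      _ = _ := by
        rw [H2.eval_comp_adjoint_eval, ContinuousLinearMap.smul_comp,
          ContinuousLinearMap.comp_smul]
        rfl
  rw [ContinuousLinearMap.sub_comp, ContinuousLinearMap.comp_sub, h3, dBRKernel, smul_sub,
    ← H2.eval_comp_adjoint_eval]
  rfl

end Kernel

/-! ### The observability operator, its gramian, and interpolation. -/

section Observability

variable {X Y : Type*} [NormedAddCommGroup X] [InnerProductSpace ℂ X]
  [NormedAddCommGroup Y] [InnerProductSpace ℂ Y] [CompleteSpace Y]
  {E : X →L[ℂ] Y} {T : X →L[ℂ] X} (h : OutputStable E T)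

theorem hasSum_observability (x : X) (z : 𝔻) :
    HasSum (fun n : ℕ => (z : ℂ) ^ n • E ((T ^ n) x)) (observability h x z) :=
  h.choose_spec x z

theorem observability_eq (x : X) :
    observability h x = H2.const Y (E x) + H2.shift Y (observability h (T x)) := by
  refine H2.ext_apply fun z => ?_
  rw [H2.add_apply, H2.const_apply, H2.shift_apply]
  refine (hasSum_observability h x z).unique ?_
  rw [← hasSum_nat_add_iff' 1]
  have h1 := (hasSum_observability h (T x) z).const_smul (z : ℂ)
  simp only [smul_smul, ← pow_succ', ← mul_apply_eq_comp, ← pow_succ] at h1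
  simpa only [Finset.sum_range_one, pow_zero, one_smul, one_apply_eq_self,
    add_sub_cancel_left] using h1

theorem backShift_observability (x : X) :
    H2.backShift Y (observability h x) = observability h (T x) := by
  rw [observability_eq h x, H2.backShift_const_add_shift]

theorem coeff_observability (x : X) (n : ℕ) : (observability h x).coeff n = E ((T ^ n) x) := by
  induction n generalizing x with
  | zero => rw [observability_eq]; simp [H2.coeff_add]
  | succ n ih => rw [← H2.coeff_backShift, backShift_observability, ih, pow_succ]; rfl

theorem norm_observability_pow_le (n : ℕ) (x : X) :
    ‖observability h ((T ^ n) x)‖ ≤ ‖observability h x‖ := by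
  induction n with
  | zero => simp
  | succ n ih =>
    rw [pow_succ', mul_apply_eq_comp, ← backShift_observability]
    exact (H2.norm_backShift_le _).trans ih

variable [CompleteSpace X]

/-- Adjoint form of `S* O = O T`; it makes `ker O*` shift-invariant. -/
theorem adjoint_observability_shift (f : H2 Y) :
    (observability h).adjoint (H2.shift Y f) = T.adjoint ((observability h).adjoint f) := by
  refine ext_inner_left ℂ fun x => ?_
  rw [ContinuousLinearMap.adjoint_inner_right, ContinuousLinearMap.adjoint_inner_right,
    ContinuousLinearMap.adjoint_inner_right, ← backShift_observability, H2.inner_backShift_left]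

/-- The coefficients of `O u` are `E Tⁿ u`, so the weak series paired with `u` is the coefficient
expansion of `⟪O u, f⟫`. -/
theorem hasLeftEval_iff (f : H2 Y) (v : X) :
    HasLeftEval E T f v ↔ (observability h).adjoint f = v := by
  have key : ∀ u, HasSum (fun n : ℕ => ⟪u, (T.adjoint ^ n) (E.adjoint (f.coeff n))⟫_ℂ)
      ⟪u, (observability h).adjoint f⟫_ℂ := fun u => by
    rw [ContinuousLinearMap.adjoint_inner_right]
    convert H2.hasSum_inner (observability h u) f using 2 with n
    rw [coeff_observability, ← ContinuousLinearMap.star_eq_adjoint T, ← star_pow,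
      ContinuousLinearMap.star_eq_adjoint, ContinuousLinearMap.adjoint_inner_right,
      ContinuousLinearMap.adjoint_inner_right]
  refine ⟨fun hv => ext_inner_left ℂ fun u => (key u).unique (hv u), ?_⟩
  rintro rfl
  exact key

variable {h} (hP : IsUnit (gramian h))
include hP

theorem inverse_gramian_apply (x : X) : Ring.inverse (gramian h) (gramian h x) = x :=
  DFunLike.congr_fun (Ring.inverse_mul_cancel _ hP) x

theorem gramian_inverse_apply (x : X) : gramian h (Ring.inverse (gramian h) x) = x :=
  DFunLike.congr_fun (Ring.mul_inverse_cancel _ hP) x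

/-- `P⁻¹ O*` is a left inverse of `O`, and `O Tⁿ = S*ⁿ O` with `S*` a contraction. The bound does
not depend on `n`. -/
theorem norm_pow_le (n : ℕ) : ‖T ^ n‖ ≤
    ‖Ring.inverse (gramian h) ∘L (observability h).adjoint‖ * ‖observability h‖ := by
  refine ContinuousLinearMap.opNorm_le_bound _ (by positivity) fun x => ?_
  have h1 := (Ring.inverse (gramian h) ∘L (observability h).adjoint).le_opNorm
    (observability h ((T ^ n) x))
  have h2 : (Ring.inverse (gramian h) ∘L (observability h).adjoint)
      (observability h ((T ^ n) x)) = (T ^ n) x := inverse_gramian_apply hP _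
  rw [h2] at h1
  refine h1.trans ?_
  rw [mul_assoc]
  gcongr
  exact (norm_observability_pow_le h n x).trans ((observability h).le_opNorm x)

/-- By power boundedness some power of `zT` has norm below 1, so `1 - (zT)ⁿ` is invertible. It
factors as `1 - zT` times a commuting geometric sum, and commuting factors of a unit are units. -/
theorem isUnit_one_sub_smul (z : 𝔻) : IsUnit (1 - (z : ℂ) • T) := by
  set C := ‖Ring.inverse (gramian h) ∘L (observability h).adjoint‖ * ‖observability h‖
  have ht := (tendsto_pow_atTop_nhds_zero_of_lt_one (norm_nonneg (z : ℂ))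
    z.norm_lt_one).mul_const C
  rw [zero_mul] at ht
  obtain ⟨n, hn⟩ := (ht.eventually_lt_const one_pos).exists
  have h1 : ‖((z : ℂ) • T) ^ n‖ < 1 := by
    rw [smul_pow, norm_smul, norm_pow]
    exact lt_of_le_of_lt (by gcongr; exact norm_pow_le hP n) hn
  have h2 : IsUnit (1 - ((z : ℂ) • T) ^ n) := isUnit_one_sub_of_norm_lt_one h1
  have hc : Commute (1 - (z : ℂ) • T) (∑ i ∈ Finset.range n, ((z : ℂ) • T) ^ i) :=
    (mul_neg_geom_sum _ n).trans (geom_sum_mul_neg _ n).symm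
  rw [← mul_neg_geom_sum] at h2
  exact (hc.isUnit_mul_iff.1 h2).1

theorem eval_comp_observability (z : 𝔻) :
    H2.eval Y z ∘L observability h = E ∘L Ring.inverse (1 - (z : ℂ) • T) := by
  ext x
  set u := Ring.inverse (1 - (z : ℂ) • T) x with hu
  have h1 : u - (z : ℂ) • T u = x :=
    DFunLike.congr_fun (Ring.mul_inverse_cancel _ (isUnit_one_sub_smul hP z)) x
  change H2.eval Y z (observability h x) = E u
  rw [← h1, map_sub, map_sub, map_smul, map_smul, H2.eval_apply, observability_eq h u,
    H2.add_apply, H2.const_apply, H2.shift_apply]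
  exact add_sub_cancel_right _ _

theorem observability_inverse_apply (x : X) (z : 𝔻) :
    observability h x z = E (Ring.inverse (1 - (z : ℂ) • T) x) :=
  DFunLike.congr_fun (eval_comp_observability hP z) x

theorem gramKernel_eq (z ζ : 𝔻) : gramKernel E T (gramian h) z ζ = H2.eval Y z ∘L
    (observability h ∘L Ring.inverse (gramian h) ∘L (observability h).adjoint) ∘L
      (H2.eval Y ζ).adjoint := by
  have h1 := congrArg ContinuousLinearMap.adjoint (eval_comp_observability hP ζ)
  have h2 : (Ring.inverse (1 - (ζ : ℂ) • T)).adjoint =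
      Ring.inverse (1 - conj (ζ : ℂ) • T.adjoint) := by
    rw [← ContinuousLinearMap.star_eq_adjoint, ← Ring.inverse_star, star_sub, star_one, star_smul,
      ContinuousLinearMap.star_eq_adjoint]
    rfl
  rw [ContinuousLinearMap.adjoint_comp, ContinuousLinearMap.adjoint_comp, h2] at h1
  rw [gramKernel, ← h1, ← ContinuousLinearMap.comp_assoc E, ← eval_comp_observability hP z]
  rfl

/-- `O P⁻¹ O*` is the projection onto the range of `O`; the remainder lies in `ker O*`. -/
theorem observability_inverse_adjoint_sub_mem (f : H2 Y) : (observability h).adjoint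
    (f - observability h (Ring.inverse (gramian h) ((observability h).adjoint f))) = 0 := by
  rw [map_sub, sub_eq_zero]
  exact (gramian_inverse_apply hP _).symm

variable {U : Type*} [NormedAddCommGroup U] [InnerProductSpace ℂ U] [CompleteSpace U]
  {B : ℂ → U →L[ℂ] Y} {L : H2 U →ₗᵢ[ℂ] H2 Y}

/-- An inner function has the kernel prescribed by the pair `(E, T)` if and only if the range of
multiplication by it is the kernel of the adjoint of the observability operator. -/
theorem dBRKernel_eq_gramKernel_iff (hL : ∀ g (z : 𝔻), L g z = B z (g z)) :
    (∀ z ζ : 𝔻, dBRKernel B z ζ = gramKernel E T (gramian h) z ζ) ↔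
      ∀ f, (observability h).adjoint f = 0 ↔ ∃ g, L g = f := by
  set M := L.toContinuousLinearMap with hM
  set O := observability h with hO
  set R := Ring.inverse (gramian h) with hR
  have hMM : ∀ g, M.adjoint (M g) = g := fun g => by
    refine ext_inner_right ℂ fun k => ?_
    rw [ContinuousLinearMap.adjoint_inner_left]
    exact L.inner_map_map g k
  -- By totality of the kernel functions, the kernel identity becomes `I - M M* = O P⁻¹ O*`, stated
  -- pointwise.
  have step : (∀ z ζ : 𝔻, dBRKernel B z ζ = gramKernel E T (gramian h) z ζ) ↔
      ∀ f, f - M (M.adjoint f) = O (R (O.adjoint f)) := by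
    constructor
    · intro hK f
      have h0 : (1 - M ∘L M.adjoint) - O ∘L R ∘L O.adjoint = 0 := by
        refine H2.eq_zero_of_eval_comp_comp_adjoint_eval fun z ζ => ?_
        rw [ContinuousLinearMap.sub_comp, ContinuousLinearMap.comp_sub, sub_eq_zero,
          ← dBRKernel_eq hL, hK, gramKernel_eq hP]
      exact DFunLike.congr_fun (sub_eq_zero.1 h0) f
    · intro hf z ζ
      rw [dBRKernel_eq hL, gramKernel_eq hP]
      congr 2
      ext1 f
      exact hf f
  rw [step]
  constructor
  · intro hf f
    constructor
    · intro h0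
      have h1 := hf f
      rw [h0, map_zero, map_zero, sub_eq_zero] at h1
      exact ⟨_, h1.symm⟩
    · rintro ⟨g, rfl⟩
      have h1 := hf (M g)
      rw [hMM, sub_self] at h1
      have h2 := congrArg O.adjoint h1
      rw [map_zero] at h2
      exact (h2.trans (gramian_inverse_apply hP _)).symm
  · intro hf f
    obtain ⟨g, hg⟩ := (hf _).1 (observability_inverse_adjoint_sub_mem hP f)
    -- The range of `M` is `ker O*`, hence orthogonal to the range of `O`. Applying `M*` to `f = M g
    -- + O P⁻¹ O* f` then identifies `g` as `M* f`.
    have hMO : ∀ x, M.adjoint (O x) = 0 := fun x => by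
      refine ext_inner_right ℂ fun k => ?_
      rw [ContinuousLinearMap.adjoint_inner_left, ← ContinuousLinearMap.adjoint_inner_right,
        (hf (M k)).2 ⟨k, rfl⟩, inner_zero_left, inner_zero_right]
    have hfe : f = M g + O (R (O.adjoint f)) := by
      rw [eq_comm, ← eq_sub_iff_add_eq]
      exact hg
    have hMf : M.adjoint f = g := by
      rw [hfe, map_add, hMM, hMO, add_zero]
    rw [hMf]
    exact sub_eq_of_eq_add' hfe

theorem exists_isInner_dBRKernel_eq :
    ∃ (Y₀ : Submodule ℂ Y) (_ : CompleteSpace Y₀) (B : ℂ → Y₀ →L[ℂ] Y), IsInner B ∧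
      ∀ z ζ : 𝔻, dBRKernel B z ζ = gramKernel E T (gramian h) z ζ := by
  have : CompleteSpace (LinearMap.ker (observability h).adjoint.toLinearMap) :=
    (observability h).adjoint.isClosed_ker.completeSpace_coe
  obtain ⟨Y₀, hY₀, B, hB, L, hL, hr⟩ := exists_isInner_of_shift_invariant
    (LinearMap.ker (observability h).adjoint.toLinearMap) fun f hf => by
      have hf' : (observability h).adjoint f = 0 := hf
      refine LinearMap.mem_ker.2 ((adjoint_observability_shift h f).trans ?_)
      rw [hf', map_zero]
  exact ⟨Y₀, hY₀, B, hB, (dBRKernel_eq_gramKernel_iff hP hL).2 hr⟩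

theorem setOf_norm_le_one_hasLeftEval (x : X) (hL : ∀ g (z : 𝔻), L g z = B z (g z))
    (hK : ∀ z ζ : 𝔻, dBRKernel B z ζ = gramKernel E T (gramian h) z ζ) :
    {f : H2 Y | ‖f‖ ≤ 1 ∧ HasLeftEval E T f x} =
      {f : H2 Y | ∃ g : H2 U, ‖g‖ ^ 2 ≤ 1 - (⟪x, Ring.inverse (gramian h) x⟫_ℂ).re ∧
        ∀ z : 𝔻, f z = E (Ring.inverse (1 - (z : ℂ) • T) (Ring.inverse (gramian h) x)) +
          B z (g z)} := by
  have hr := (dBRKernel_eq_gramKernel_iff hP hL).1 hK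
  set R := Ring.inverse (gramian h) with hR
  have hv : ∀ (f : H2 Y) (g : H2 U), (∀ z : 𝔻, f z =
      E (Ring.inverse (1 - (z : ℂ) • T) (R x)) + B z (g z)) ↔
        f = observability h (R x) + L g := fun f g => by
    constructor
    · exact fun hf => H2.ext_apply fun z => by
        rw [hf, H2.add_apply, observability_inverse_apply hP, hL]
    · rintro rfl z
      rw [H2.add_apply, observability_inverse_apply hP, hL]
  -- Pythagoras: `L g` lies in `ker O*` and so is orthogonal to `O P⁻¹ x`, whose squared norm is `⟪P
  -- P⁻¹ x, P⁻¹ x⟫`.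
  have hn : ∀ g : H2 U, ‖observability h (R x) + L g‖ ^ 2 = (⟪x, R x⟫_ℂ).re + ‖g‖ ^ 2 := by
    intro g
    have h0 : ⟪observability h (R x), L g⟫_ℂ = 0 := by
      rw [← ContinuousLinearMap.adjoint_inner_right, (hr _).2 ⟨g, rfl⟩, inner_zero_right]
    have h1 := norm_add_sq_eq_norm_sq_add_norm_sq_of_inner_eq_zero _ _ h0
    simp only [← sq] at h1
    rw [h1, LinearIsometry.norm_map]
    congr 1
    have h2 : ⟪observability h (R x), observability h (R x)⟫_ℂ = ⟪x, R x⟫_ℂ := by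
      rw [← ContinuousLinearMap.adjoint_inner_left]
      exact congrArg (⟪·, R x⟫_ℂ) (gramian_inverse_apply hP x)
    rw [← h2, inner_self_eq_norm_sq_to_K]
    norm_cast
  ext f
  simp only [Set.mem_ofPred_eq, hasLeftEval_iff h, hv]
  constructor
  · rintro ⟨hf, rfl⟩
    obtain ⟨g, hg⟩ := (hr _).1 (observability_inverse_adjoint_sub_mem hP f)
    have hfe : f = observability h (R ((observability h).adjoint f)) + L g := by
      rw [hg, add_sub_cancel]
    refine ⟨g, ?_, hfe⟩
    have h1 := hn g
    rw [← hfe] at h1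
    have h2 := pow_le_one₀ (n := 2) (norm_nonneg f) hf
    linarith
  · rintro ⟨g, hg, rfl⟩
    have h1 := hn g
    refine ⟨?_, ?_⟩
    · rw [← sq_le_one_iff₀ (norm_nonneg _)]
      linarith
    · rw [map_add, (hr _).2 ⟨g, rfl⟩, add_zero]
      exact gramian_inverse_apply hP x

end Observability

/-! ### Uniqueness of the inner function up to a unitary factor. -/

section Uniqueness

variable {U₁ U₂ Y : Type*} [NormedAddCommGroup U₁] [InnerProductSpace ℂ U₁] [CompleteSpace U₁]
  [NormedAddCommGroup U₂] [InnerProductSpace ℂ U₂] [CompleteSpace U₂]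
  [NormedAddCommGroup Y] [InnerProductSpace ℂ Y] [CompleteSpace Y]

theorem multiplier_shift {B : ℂ → U₁ →L[ℂ] Y} {L : H2 U₁ →ₗᵢ[ℂ] H2 Y}
    (hL : ∀ g (z : 𝔻), L g z = B z (g z)) (g : H2 U₁) :
    L (H2.shift U₁ g) = H2.shift Y (L g) :=
  H2.ext_apply fun z => by rw [hL, H2.shift_apply, H2.shift_apply, hL, map_smul]

/-- If `L₁ g = L₂ u` with `u` constant, then `g` is orthogonal to all shifts: `L₁ k = L₂ k'` by
equality of ranges, and both multipliers commute with the shift, so `⟪g, S k⟫ = ⟪u, S k'⟫ = 0`.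
Hence `g` is constant. -/
theorem exists_multiplier_const_eq {B₁ : ℂ → U₁ →L[ℂ] Y} {B₂ : ℂ → U₂ →L[ℂ] Y}
    {L₁ : H2 U₁ →ₗᵢ[ℂ] H2 Y} {L₂ : H2 U₂ →ₗᵢ[ℂ] H2 Y}
    (h₁ : ∀ g (z : 𝔻), L₁ g z = B₁ z (g z)) (h₂ : ∀ g (z : 𝔻), L₂ g z = B₂ z (g z))
    (hr : ∀ f, (∃ g, L₁ g = f) ↔ ∃ g, L₂ g = f) (u : U₂) :
    ∃ v, L₁ (H2.const U₁ v) = L₂ (H2.const U₂ u) := by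
  obtain ⟨g, hg⟩ := (hr _).2 ⟨H2.const U₂ u, rfl⟩
  refine ⟨g.coeff 0, ?_⟩
  rw [← H2.eq_const_of_orthogonal, hg]
  intro k
  obtain ⟨k', hk'⟩ := (hr _).1 ⟨k, rfl⟩
  rw [← L₁.inner_map_map, hg, multiplier_shift h₁, ← hk', ← multiplier_shift h₂,
    L₂.inner_map_map, H2.inner_const_shift]

/-- Inner functions that multiply onto the same subspace agree up to a constant unitary factor on
the right. -/
theorem exists_unitary_of_range_eq {B₁ : ℂ → U₁ →L[ℂ] Y} {B₂ : ℂ → U₂ →L[ℂ] Y}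
    {L₁ : H2 U₁ →ₗᵢ[ℂ] H2 Y} {L₂ : H2 U₂ →ₗᵢ[ℂ] H2 Y}
    (h₁ : ∀ g (z : 𝔻), L₁ g z = B₁ z (g z)) (h₂ : ∀ g (z : 𝔻), L₂ g z = B₂ z (g z))
    (hr : ∀ f, (∃ g, L₁ g = f) ↔ ∃ g, L₂ g = f) :
    ∃ V : U₂ ≃ₗᵢ[ℂ] U₁, ∀ (z : 𝔻) (u : U₂), B₂ z u = B₁ z (V u) := by
  let J₁ := L₁.comp (H2.const U₁)
  let J₂ := L₂.comp (H2.const U₂)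
  choose v hv using exists_multiplier_const_eq h₁ h₂ hr
  have hv' : ∀ u, J₁ (v u) = J₂ u := hv
  let V : U₂ →ₗᵢ[ℂ] U₁ :=
    { toFun := v
      map_add' := fun u u' => J₁.injective (by simp only [map_add, hv'])
      map_smul' := fun c u => J₁.injective (by simp only [map_smul, hv', RingHom.id_apply])
      norm_map' := fun u => by
        change ‖v u‖ = ‖u‖
        rw [← J₁.norm_map, hv', J₂.norm_map] }
  -- The same lemma with the roles of the two multipliers exchanged.
  have hV : Function.Surjective V := fun w => by
    obtain ⟨u, hu⟩ := exists_multiplier_const_eq h₂ h₁ (fun f => (hr f).symm) w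
    exact ⟨u, J₁.injective ((hv u).trans hu)⟩
  refine ⟨LinearIsometryEquiv.ofSurjective V hV, fun z u => ?_⟩
  have h := congrArg (H2.eval Y z) (hv u)
  rw [H2.eval_apply, H2.eval_apply, h₁, h₂, H2.const_apply, H2.const_apply] at h
  exact h.symm

end Uniqueness

end Hardy

end

theorem theoremT {X : Type*} {Y : Type*}
    [NormedAddCommGroup X] [InnerProductSpace ℂ X] [CompleteSpace X]
    [NormedAddCommGroup Y] [InnerProductSpace ℂ Y] [CompleteSpace Y]
    (E : X →L[ℂ] Y) (T : X →L[ℂ] X) (x : X)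
    (hET : Hardy.OutputStable E T)
    (hP : Hardy.PositiveDefinite (Hardy.gramian hET))
    (hx : InnerProductSpace.rankOne ℂ x x ≤ Hardy.gramian hET) :
    -- the resolvents in the formulas exist
    (∀ z : 𝔻, IsUnit (1 - (z : ℂ) • T)) ∧
    -- an inner function with the prescribed kernel exists, with a closed subspace of `Y` as
    -- coefficient space
    (∃ (Y₀ : Submodule ℂ Y) (_ : CompleteSpace Y₀) (B : ℂ → Y₀ →L[ℂ] Y), Hardy.IsInner B ∧
      ∀ z ζ : 𝔻, Hardy.dBRKernel B z ζ = Hardy.gramKernel E T (Hardy.gramian hET) z ζ) ∧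
    -- it is unique up to a constant unitary factor on the right
    (∀ (Y₁ : Type*) [NormedAddCommGroup Y₁] [InnerProductSpace ℂ Y₁] [CompleteSpace Y₁]
      (Y₂ : Type*) [NormedAddCommGroup Y₂] [InnerProductSpace ℂ Y₂] [CompleteSpace Y₂]
      (B₁ : ℂ → Y₁ →L[ℂ] Y) (B₂ : ℂ → Y₂ →L[ℂ] Y),
      Hardy.IsInner B₁ →
      (∀ z ζ : 𝔻, Hardy.dBRKernel B₁ z ζ = Hardy.gramKernel E T (Hardy.gramian hET) z ζ) →
      Hardy.IsInner B₂ →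
      (∀ z ζ : 𝔻, Hardy.dBRKernel B₂ z ζ = Hardy.gramKernel E T (Hardy.gramian hET) z ζ) →
      ∃ V : Y₂ ≃ₗᵢ[ℂ] Y₁, ∀ (z : 𝔻) (y : Y₂), B₂ z y = B₁ z (V y)) ∧
    -- any such inner function parametrizes the set of all solutions
    (∀ (Y₀ : Type*) [NormedAddCommGroup Y₀] [InnerProductSpace ℂ Y₀] [CompleteSpace Y₀]
      (B : ℂ → Y₀ →L[ℂ] Y), Hardy.IsInner B →
      (∀ z ζ : 𝔻, Hardy.dBRKernel B z ζ = Hardy.gramKernel E T (Hardy.gramian hET) z ζ) →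
      {f : Hardy.H2 Y | ‖f‖ ≤ 1 ∧ Hardy.HasLeftEval E T f x} =
        {f : Hardy.H2 Y | ∃ h : Hardy.H2 Y₀,
          ‖h‖ ^ 2 ≤ 1 - (⟪x, Ring.inverse (Hardy.gramian hET) x⟫_ℂ).re ∧
          ∀ z : 𝔻, f z =
            E (Ring.inverse (1 - (z : ℂ) • T) (Ring.inverse (Hardy.gramian hET) x)) +
              B z (h z)}) := by

  have hu := hP.2
  refine ⟨Hardy.isUnit_one_sub_smul hu, Hardy.exists_isInner_dBRKernel_eq hu, ?_, ?_⟩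
  · intro Y₁ _ _ _ Y₂ _ _ _ B₁ B₂ hB₁ hK₁ hB₂ hK₂
    obtain ⟨L₁, hL₁⟩ := hB₁.exists_linearIsometry
    obtain ⟨L₂, hL₂⟩ := hB₂.exists_linearIsometry
    -- Both ranges equal `ker O*`.
    exact Hardy.exists_unitary_of_range_eq hL₁ hL₂ fun f =>
      ((Hardy.dBRKernel_eq_gramKernel_iff hu hL₁).1 hK₁ f).symm.trans
        ((Hardy.dBRKernel_eq_gramKernel_iff hu hL₂).1 hK₂ f)
  · intro Y₀ _ _ _ B hB hK
    obtain ⟨L, hL⟩ := hB.exists_linearIsometry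
    exact Hardy.setOf_norm_le_one_hasLeftEval hu x hL hK
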